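/- Let $r\ge 2$, let $G$ be a finite complete $r$-partite graph (the vertex set $V$ is a disjoint union of nonempty sets $V_1,\dots,V_r$, and two vertices are adjacent if and only if they lie in different $V_i$), and let $K$ be a field. Let $$J_G=\bigl(x_ay_b-x_by_a : \{a,b\}\in E(G)\bigr)\subset S=K[x_a,y_a : a\in V]$$ be the binomial edge ideal of $G$. Then $J_G$ is of König type. That is, if $h$ is the height of $J_G$, there exist a monomial order $<$ on $S$ and polynomials $f_1,\dots,f_h$ that form part of a minimal system of homogeneous generators of $J_G$ (with respect to the standard grading) such that the initial monomials $\operatorname{in}_<(f_1),\dots,\operatorname{in}_<(f_h)$ form a regular sequence in $S$. -/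

import Mathlib

universe u v

/-- `G` is a complete `r`-partite graph: its vertex set is partitioned into `r` nonempty parts (the
fibres of `part`), and two vertices are adjacent exactly when they lie in different parts. -/
def SimpleGraph.IsCompletePartite {V : Type u} (G : SimpleGraph V) (r : ℕ) : Prop :=
  ∃ part : V → Fin r, Function.Surjective part ∧ ∀ a b : V, G.Adj a b ↔ part a ≠ part b

/-- The binomial edge ideal `J_G` of `G`, generated by the `2`-minors
`x_a y_b - x_b y_a` over all edges `{a, b}` of `G`, in the polynomial ring over `K` in the variables
`x_a = X (0, a)` and `y_a = X (1, a)`, with `a` a vertex. -/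
noncomputable def SimpleGraph.binomialEdgeIdeal {V : Type u} (K : Type v) [Field K]
    (G : SimpleGraph V) : Ideal (MvPolynomial (Fin 2 × V) K) :=
  Ideal.span {f | ∃ a b : V, G.Adj a b ∧
    f = MvPolynomial.X (0, a) * MvPolynomial.X (1, b)
      - MvPolynomial.X (0, b) * MvPolynomial.X (1, a)}

/-- `B` is a minimal system of homogeneous generators of the ideal `I` (for the standard grading):
it consists of homogeneous polynomials, generates `I`, and no member of `B` can be left out. -/
def MvPolynomial.IsMinimalHomogeneousGenerators {σ : Type u} {K : Type v} [Field K]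
    (B : Set (MvPolynomial σ K)) (I : Ideal (MvPolynomial σ K)) : Prop :=
  (∀ f ∈ B, ∃ d : ℕ, f.IsHomogeneous d) ∧ Ideal.span B = I ∧
    ∀ f ∈ B, f ∉ Ideal.span (B \ {f})

/-- The initial monomial `in_<(f)` of a nonzero polynomial `f` for the monomial order `m`. -/
noncomputable def MonomialOrder.initialMonomial {σ : Type u} {K : Type v} [Field K]
    (m : MonomialOrder.{u, u} σ) (f : MvPolynomial σ K) : MvPolynomial σ K :=
  MvPolynomial.monomial (m.degree f) 1

/-- A graded ideal `I` of height `h` is of König type with respect to the monomial order `m` if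
there are polynomials `f_1, …, f_h` that form part of a minimal system of homogeneous generators
of `I` and whose initial monomials form a regular sequence. -/
def MvPolynomial.IsKonigTypeWrt {σ : Type u} {K : Type v} [Field K]
    (m : MonomialOrder.{u, u} σ) (I : Ideal (MvPolynomial σ K)) : Prop :=
  ∃ fs : List (MvPolynomial σ K), (fs.length : ℕ∞) = I.height ∧ fs.Nodup ∧
    (∃ B : Set (MvPolynomial σ K),
      MvPolynomial.IsMinimalHomogeneousGenerators B I ∧ ∀ f ∈ fs, f ∈ B) ∧
    RingTheory.Sequence.IsRegular (MvPolynomial σ K) (fs.map m.initialMonomial)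

/-- `I` is of König type if it is so with respect to some monomial order. -/
def MvPolynomial.IsKonigType {σ : Type u} {K : Type v} [Field K]
    (I : Ideal (MvPolynomial σ K)) : Prop :=
  ∃ m : MonomialOrder.{u, u} σ, MvPolynomial.IsKonigTypeWrt m I

/-! Let n = |V|, let V₀ be a largest part, m = n - |V₀| and h = min (n - 1) (2m). A prime containing
`J_G` either has nonzero columns from two different parts, which forces all 2-minors into it (height
at least n - 1), or kills every column outside one part (height at least 2m). Conversely `J_G` lies
in the prime of all 2-minors and in the ideal of the variables outside V₀, so its height is h. On
the other side, `G` has a path with h edges: a Hamiltonian path if |V₀| ≤ m + 1, otherwise one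
alternating between V₀ and its complement. Number the vertices along the path and use a
lexicographic order with leading diagonal terms. The edges p_i p_{i+1} then have initial monomials
x_{p_i} y_{p_{i+1}}, which are pairwise coprime and hence a regular sequence. -/

namespace MvPolynomial

/-! ### Regular sequences of monomials and diagonal orders -/

open RingTheory.Sequence in
/-- Nonconstant monomials with pairwise disjoint supports form a regular sequence. -/
theorem isRegular_map_monomial {σ : Type u} {K : Type v} [Field K] (es : List (σ →₀ ℕ))
    (hne : ∀ e ∈ es, e ≠ 0) (hd : es.Pairwise fun a b => Disjoint a.support b.support) :
    IsRegular (MvPolynomial σ K) (es.map fun e => monomial e (1 : K)) := by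
  have key : ∀ es' : List (σ →₀ ℕ), (Ideal.ofList (es'.map fun e => monomial e (1 : K)) •
      (⊤ : Submodule (MvPolynomial σ K) (MvPolynomial σ K))) =
      Ideal.span ((fun e => monomial e (1 : K)) '' {e | e ∈ es'}) := by
    intro es'
    rw [smul_eq_mul, Ideal.mul_top, Ideal.ofList]
    congr 1
    ext x
    simp
  refine ⟨⟨fun i hi => ?_⟩, ?_⟩
  · rw [← List.map_take, key, isSMulRegular_quotient_iff_mem_of_smul_mem]
    intro f hf
    rw [List.length_map] at hi
    rw [mem_ideal_span_monomial_image] at hf ⊢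
    intro β hβ
    simp only [List.getElem_map, smul_eq_mul] at hf
    obtain ⟨e, he, hle⟩ := hf (es[i] + β) (by
      rw [mem_support_iff] at hβ ⊢
      rwa [coeff_monomial_mul, one_mul])
    -- An earlier monomial dividing the product is coprime to `es[i]`, so it divides the other
    -- factor.
    refine ⟨e, he, fun j => ?_⟩
    obtain ⟨k, hk, rfl⟩ := List.mem_take_iff_getElem.mp he
    have hdis := List.pairwise_iff_getElem.mp hd k i (by omega) hi (by omega)
    by_cases hj : j ∈ es[k].support
    · have hji := Finset.disjoint_left.mp hdis hj
      rw [Finsupp.notMem_support_iff] at hji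
      simpa [hji] using hle j
    · rw [Finsupp.notMem_support_iff] at hj
      simp [hj]
  · rw [key]
    intro h
    have h1 : (1 : MvPolynomial σ K) ∈ Ideal.span ((fun e => monomial e (1 : K)) '' {e | e ∈ es}) :=
      h ▸ Submodule.mem_top
    rw [mem_ideal_span_monomial_image] at h1
    obtain ⟨e, he, hle⟩ := h1 0 (by simp)
    exact hne e he (le_antisymm hle (by simp))

end MvPolynomial

open MvPolynomial in
/-- In the lexicographic order, the leading monomial of `X a * X b - X c * X d` is `X a * X b`
when `X a` is the largest of the variables that occur. -/
theorem MonomialOrder.degree_lex_minor {σ : Type u} {K : Type v} [Field K] [LinearOrder σ]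
    [WellFoundedGT σ] {a b c d : σ} (hab : a ≤ b) (hac : a < c) (had : a < d) :
    (MonomialOrder.lex (σ := σ)).degree (X a * X b - X c * X d : MvPolynomial σ K) =
      Finsupp.single a 1 + Finsupp.single b 1 := by
  have hX : ∀ i j : σ, (MonomialOrder.lex (σ := σ)).degree (X i * X j : MvPolynomial σ K) =
      Finsupp.single i 1 + Finsupp.single j 1 := fun i j => by
    rw [degree_mul (X_ne_zero i) (X_ne_zero j), degree_X, degree_X]
  rw [degree_sub_of_lt, hX]
  rw [hX, hX, MonomialOrder.lex_lt_iff, Finsupp.Lex.lt_iff]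
  -- Smaller indices are larger variables, so the comparison is decided at `a`.
  refine ⟨a, fun j hj => ?_, ?_⟩
  · simp [hj.ne', (hj.trans_le hab).ne', (hj.trans hac).ne', (hj.trans had).ne']
  · simp [hac.ne', had.ne']

/-- A monomial order for which the `x`-variables are compared through `g` and are larger than the
`y`-variables: it selects the diagonal term of each `2`-minor. -/
theorem exists_diagonal_monomialOrder {V : Type u} [Finite V] (K : Type v) [Field K] (g : V → ℕ)
    (hg : Function.Injective g) :
    ∃ m : MonomialOrder.{u, u} (Fin 2 × V), ∀ a b : V, g a < g b →
      m.degree (MvPolynomial.X (0, a) * MvPolynomial.X (1, b)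
        - MvPolynomial.X (0, b) * MvPolynomial.X (1, a) : MvPolynomial (Fin 2 × V) K) =
      Finsupp.single (0, a) 1 + Finsupp.single (1, b) 1 := by
  let key : Fin 2 × V → ℕ ×ₗ ℕ := fun i => toLex (i.1.val, g i.2)
  have hkey : Function.Injective key := by
    rintro ⟨i, a⟩ ⟨j, b⟩ h
    have h' := Prod.mk.inj (toLex.injective h)
    exact Prod.ext (Fin.ext h'.1) (hg h'.2)
  let : LinearOrder (Fin 2 × V) := LinearOrder.lift' key hkey
  have hlt : ∀ i j : Fin 2 × V, i < j ↔ key i < key j := fun i j => Iff.rfl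
  have : WellFoundedGT (Fin 2 × V) := Finite.to_wellFoundedGT
  refine ⟨MonomialOrder.lex, fun a b hab => ?_⟩
  have h01 : ∀ a b : V, ((0, a) : Fin 2 × V) < (1, b) := fun a b => by
    rw [hlt, Prod.Lex.toLex_lt_toLex]
    left
    simp
  apply MonomialOrder.degree_lex_minor (h01 _ _).le _ (h01 _ _)
  rw [hlt, Prod.Lex.toLex_lt_toLex]
  exact Or.inr ⟨rfl, hab⟩

/-! ### Long paths in complete multipartite graphs -/

open Finset in
/-- A finite set coloured so that no colour occurs too often can be listed without consecutive
equal colours, the first element avoiding the colour `i`. -/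
theorem exists_isChain_ne_of_card_le {V : Type u} [DecidableEq V] {C : Type v} [DecidableEq C]
    (c : V → C) (s : Finset V) (i : C) (hi : 2 * #{v ∈ s | c v = i} ≤ #s)
    (hc : ∀ j, 2 * #{v ∈ s | c v = j} ≤ #s + 1) :
    ∃ l : List V, l.Nodup ∧ l.toFinset = s ∧ l.IsChain (fun a b => c a ≠ c b) ∧
      ∀ a ∈ l.head?, c a ≠ i := by
  induction hn : #s generalizing s i with
  | zero =>
    rw [card_eq_zero] at hn
    exact ⟨[], by simp [hn]⟩
  | succ n ih =>
    rw [hn] at hi hc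
    -- A colour attaining the bound must be used at once. It is not `i`, and no other colour can be
    -- as frequent. If there is none, any vertex not coloured `i` will do.
    obtain ⟨a, has, hai, hk⟩ : ∃ a ∈ s, c a ≠ i ∧
        ∀ k, k ≠ c a → 2 * #{v ∈ s | c v = k} ≤ n + 1 := by
      by_cases h : ∃ j, 2 * #{v ∈ s | c v = j} = n + 2
      · obtain ⟨j, hj⟩ := h
        obtain ⟨a, ha⟩ := card_pos.mp (show 0 < #{v ∈ s | c v = j} by omega)
        obtain ⟨has, rfl⟩ := mem_filter.mp ha
        refine ⟨a, has, fun h => ?_, fun k hk => ?_⟩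
        · rw [h] at hj
          omega
        · have hdis : Disjoint {v ∈ s | c v = k} {v ∈ s | c v = c a} :=
            disjoint_filter.mpr fun v _ h1 h2 => hk (h1.symm.trans h2)
          have := card_le_card (union_subset (filter_subset (fun v => c v = k) s)
            (filter_subset (fun v => c v = c a) s))
          rw [card_union_of_disjoint hdis] at this
          omega
      · push Not at h
        have hpos : 0 < #{v ∈ s | ¬ c v = i} := by
          have := card_filter_add_card_filter_not (s := s) (fun v => c v = i)
          omega
        obtain ⟨a, ha⟩ := card_pos.mp hpos
        obtain ⟨has, hai⟩ := mem_filter.mp ha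
        refine ⟨a, has, hai, fun k _ => ?_⟩
        have h1 := hc k
        have h2 := h k
        omega
    have hcard : #(s.erase a) = n := by rw [card_erase_of_mem has, hn]; rfl
    have hca : #{v ∈ s.erase a | c v = c a} + 1 = #{v ∈ s | c v = c a} := by
      rw [filter_erase, card_erase_of_mem (by simp [has])]
      exact Nat.sub_add_cancel (card_pos.mpr ⟨a, by simp [has]⟩)
    have hca' := hc (c a)
    obtain ⟨l, hl, hls, hlc, hlh⟩ := ih (s.erase a) (c a) (by omega) (fun k => by
      rw [hcard]
      by_cases hka : k = c a
      · subst hka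
        omega
      · exact (Nat.mul_le_mul_left 2
          (card_le_card (filter_subset_filter _ (erase_subset a s)))).trans (hk k hka)) hcard
    refine ⟨a :: l, ?_, ?_, ?_, ?_⟩
    · rw [List.nodup_cons]
      refine ⟨fun h => ?_, hl⟩
      rw [← List.mem_toFinset, hls] at h
      simp at h
    · rw [List.toFinset_cons, hls, insert_erase has]
    · rw [List.isChain_cons]
      exact ⟨fun b hb => (hlh b hb).symm, hlc⟩
    · simpa using hai

open Finset in
/-- A complete multipartite graph with largest part of index `i₀` has a path with
`min (n - 1) (2 * (n - |V_{i₀}|))` edges. -/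
theorem exists_path_of_part {V : Type u} [Fintype V] [DecidableEq V] {r : ℕ} (part : V → Fin r)
    (i₀ : Fin r) (hmax : ∀ i, #{v | part v = i} ≤ #{v | part v = i₀}) (hpos : 0 < Fintype.card V) :
    ∃ p : Fin (min (Fintype.card V - 1) (2 * #{v | part v ≠ i₀}) + 1) → V,
      Function.Injective p ∧
      ∀ i : Fin (min (Fintype.card V - 1) (2 * #{v | part v ≠ i₀})),
        part (p i.castSucc) ≠ part (p i.succ) := by
  have hsum : #{v | part v = i₀} + #{v | part v ≠ i₀} = Fintype.card V :=
    card_filter_add_card_filter_not (s := univ) (fun v => part v = i₀)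
  have hother : ∀ i, i ≠ i₀ → #{v | part v = i} ≤ #{v | part v ≠ i₀} := fun i hi =>
    card_le_card fun v => by simp only [mem_filter_univ]; rintro rfl; exact hi
  obtain ⟨s, hs, hc⟩ : ∃ s : Finset V,
      #s = min (Fintype.card V - 1) (2 * #{v | part v ≠ i₀}) + 1 ∧
      ∀ j, 2 * #{v ∈ s | part v = j} ≤ #s + 1 := by
    by_cases h : #{v | part v = i₀} ≤ #{v | part v ≠ i₀} + 1
    · refine ⟨univ, ?_, fun j => ?_⟩
      · rw [card_univ]
        omega
      · have := hmax j
        rw [card_univ]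
        omega
    -- Truncate the largest part to one vertex more than its complement.
    · obtain ⟨t, hts, ht⟩ := exists_subset_card_eq (show #{v | part v ≠ i₀} + 1 ≤
        #{v | part v = i₀} by omega)
      have hdis : Disjoint t (filter (fun v => part v ≠ i₀) univ) :=
        disjoint_of_subset_left hts (disjoint_filter_filter_not _ _ _)
      have hcard : #(t ∪ filter (fun v => part v ≠ i₀) univ) = 2 * #{v | part v ≠ i₀} + 1 := by
        rw [card_union_of_disjoint hdis]
        omega
      refine ⟨t ∪ filter (fun v => part v ≠ i₀) univ, by omega, fun j => ?_⟩
      rw [hcard]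
      by_cases hj : j = i₀
      · have : {v ∈ t ∪ filter (fun v => part v ≠ i₀) univ | part v = j} ⊆ t := fun v hv => by
          simp only [mem_filter, mem_union, mem_univ, true_and] at hv
          exact hv.1.resolve_right fun h => h (hv.2.trans hj)
        have := card_le_card this
        omega
      · have : {v ∈ t ∪ filter (fun v => part v ≠ i₀) univ | part v = j} ⊆ ({v | part v = j} : Finset V) :=
          filter_subset_filter _ (subset_univ _)
        have := (card_le_card this).trans (hother j hj)
        omega
  -- The colour `none` never occurs, so the first vertex is unrestricted.
  obtain ⟨l, hl, rfl, hlc, -⟩ := exists_isChain_ne_of_card_le (fun v => some (part v)) s none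
    (by simp) (fun j => by cases j <;> simp [hc])
  rw [List.toFinset_card_of_nodup hl] at hs
  refine ⟨fun i => l[i.val], fun i j hij => Fin.ext ((hl.getElem_inj_iff).mp hij), fun i => ?_⟩
  have := List.isChain_iff_getElem.mp hlc i.val (by omega)
  simpa using this

/-! ### Heights of variable ideals and of the generic rank-one prime -/

namespace MvPolynomial

/-- The `2`-minor `x_a y_b - x_b y_a` of the generic `2 × V` matrix. -/
noncomputable def genericMinor {V : Type u} (K : Type v) [Field K] (a b : V) :
    MvPolynomial (Fin 2 × V) K :=
  X (0, a) * X (1, b) - X (0, b) * X (1, a)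

section Variables

variable {σ : Type u} {K : Type v} [Field K]

/-- The substitution that sends the variables in `A` to zero. -/
noncomputable def killVars [DecidableEq σ] (A : Finset σ) :
    MvPolynomial σ K →ₐ[K] MvPolynomial σ K :=
  aeval fun i => if i ∈ A then 0 else X i

theorem killVars_X [DecidableEq σ] (A : Finset σ) (i : σ) :
    killVars A (X i : MvPolynomial σ K) = if i ∈ A then 0 else X i :=
  aeval_X _ _

/-- The quotient map modulo `I` factors through the substitution. -/
theorem ker_killVars_le [DecidableEq σ] {A : Finset σ} {I : Ideal (MvPolynomial σ K)}
    (hA : ∀ i ∈ A, X i ∈ I) : RingHom.ker (killVars (K := K) A) ≤ I := by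
  have h : (Ideal.Quotient.mkₐ K I).comp (killVars A) = Ideal.Quotient.mkₐ K I := by
    refine algHom_ext fun i => ?_
    rw [AlgHom.comp_apply, killVars_X]
    split_ifs with hi
    · rw [map_zero]
      exact (Ideal.Quotient.eq_zero_iff_mem.mpr (hA i hi)).symm
    · rfl
  intro f hf
  rw [RingHom.mem_ker] at hf
  rw [← Ideal.Quotient.eq_zero_iff_mem]
  have := DFunLike.congr_fun h f
  rw [AlgHom.comp_apply, hf, map_zero] at this
  exact this.symm

/-- Killing the variables one at a time gives a strict chain of primes. -/
theorem card_le_height_ker_killVars [DecidableEq σ] (A : Finset σ) :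
    (A.card : ℕ∞) ≤ (RingHom.ker (killVars (K := K) A)).height := by
  induction A using Finset.induction_on with
  | empty => simp
  | insert a A ha ih =>
    have := RingHom.ker_isPrime (killVars (K := K) A)
    have := RingHom.ker_isPrime (killVars (K := K) (insert a A))
    have hX : ∀ (B : Finset σ), ∀ i ∈ B, (X i : MvPolynomial σ K) ∈ RingHom.ker (killVars B) :=
      fun B i hi => by rw [RingHom.mem_ker, killVars_X, if_pos hi]
    have hlt : RingHom.ker (killVars (K := K) A) < RingHom.ker (killVars (K := K) (insert a A)) := by
      refine SetLike.lt_iff_le_and_exists.mpr ⟨ker_killVars_le fun i hi =>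
        hX _ i (Finset.mem_insert_of_mem hi), X a, hX _ a (Finset.mem_insert_self a A), ?_⟩
      rw [RingHom.mem_ker, killVars_X, if_neg ha]
      exact X_ne_zero a
    rw [Finset.card_insert_of_notMem ha]
    push_cast
    exact (add_le_add_left ih 1).trans (Ideal.height_add_one_le_of_lt_of_isPrime hlt)

theorem card_le_height_of_X_mem (A : Finset σ) {I : Ideal (MvPolynomial σ K)}
    (hA : ∀ i ∈ A, X i ∈ I) : (A.card : ℕ∞) ≤ I.height := by
  classical
  exact (card_le_height_ker_killVars A).trans (Ideal.height_mono (ker_killVars_le hA))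

theorem span_ne_top_of_eval_eq_zero {s : Set (MvPolynomial σ K)}
    (hs : ∀ f ∈ s, eval (0 : σ → K) f = 0) : Ideal.span s ≠ ⊤ := by
  refine ne_top_of_le_ne_top (RingHom.ker_ne_top (eval (0 : σ → K))) ?_
  exact Ideal.span_le.mpr fun f hf => hs f hf

theorem height_span_le_card [Finite σ] (t : Finset (MvPolynomial σ K))
    (ht : Ideal.span (t : Set (MvPolynomial σ K)) ≠ ⊤) :
    (Ideal.span (t : Set (MvPolynomial σ K))).height ≤ t.card := by
  obtain ⟨p, hp⟩ := Ideal.nonempty_minimalPrimes ht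
  exact (Ideal.height_mono hp.1.2).trans (Ideal.height_le_card_of_mem_minimalPrimes_span_finset hp)

end Variables

section Rank

variable {V : Type u} {K : Type v} [Field K] [DecidableEq V]

/-- The substitution that replaces the columns in `A` of the generic `2 × V` matrix by the columns
of a generic matrix of rank one. -/
noncomputable def rankOneMap (K : Type v) [Field K] (A : Finset V) :
    MvPolynomial (Fin 2 × V) K →ₐ[K] MvPolynomial (Fin 2 × V ⊕ Fin 2) K :=
  aeval fun i => if i.2 ∈ A then X (Sum.inr i.1) * X (Sum.inl (0, i.2)) else X (Sum.inl i)

theorem rankOneMap_X (A : Finset V) (i : Fin 2 × V) : rankOneMap K A (X i) =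
    if i.2 ∈ A then X (Sum.inr i.1) * X (Sum.inl (0, i.2)) else X (Sum.inl i) :=
  aeval_X _ _

theorem genericMinor_mem_ker_rankOneMap {A : Finset V} {a b : V} (ha : a ∈ A) (hb : b ∈ A) :
    genericMinor K a b ∈ RingHom.ker (rankOneMap K A) := by
  rw [RingHom.mem_ker, genericMinor]
  simp only [map_sub, map_mul, rankOneMap_X, ha, hb, if_true]
  ring

theorem genericMinor_notMem_ker_rankOneMap {A : Finset V} {a b : V} (ha : a ∈ A) (hb : b ∉ A) :
    genericMinor K a b ∉ RingHom.ker (rankOneMap K A) := by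
  rw [RingHom.mem_ker, genericMinor]
  simp only [map_sub, map_mul, rankOneMap_X, ha, hb, if_true, if_false]
  intro h
  have := congrArg (eval fun j : Fin 2 × V ⊕ Fin 2 =>
    Sum.elim (fun i : Fin 2 × V => if i = (0, b) then (0 : K) else 1) (fun _ => 1) j) h
  have hab : a ≠ b := by rintro rfl; exact hb ha
  simp [hab] at this

theorem ker_rankOneMap_le_insert {A : Finset V} {b : V} (hb : b ∉ A) :
    RingHom.ker (rankOneMap K A) ≤ RingHom.ker (rankOneMap K (insert b A)) := by
  have h : rankOneMap K (insert b A) =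
      (aeval (Sum.elim (fun i : Fin 2 × V => if i.2 = b then X (Sum.inr i.1) * X (Sum.inl (0, i.2))
        else X (Sum.inl i)) fun j => X (Sum.inr j))).comp (rankOneMap K A) := by
    refine algHom_ext fun i => ?_
    rw [AlgHom.comp_apply, rankOneMap_X, rankOneMap_X]
    by_cases hi : i.2 ∈ A
    · have : i.2 ≠ b := by rintro rfl; exact hb hi
      simp [hi, this]
    · by_cases hib : i.2 = b <;> simp [hi, hib, hb]
  intro f hf
  rw [RingHom.mem_ker] at hf ⊢
  rw [h, AlgHom.comp_apply, hf, map_zero]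

/-- Making the columns proportional one at a time gives a strict chain of primes; the first column
imposes no condition, hence the `+ 1`. -/
theorem card_le_height_ker_rankOneMap_add_one {A : Finset V} (hA : A.Nonempty) :
    (A.card : ℕ∞) ≤ (RingHom.ker (rankOneMap K A)).height + 1 := by
  induction hA using Finset.Nonempty.cons_induction with
  | singleton a => simp
  | cons b A hb hA ih =>
    obtain ⟨a, ha⟩ := hA
    have := RingHom.ker_isPrime (rankOneMap K A)
    have := RingHom.ker_isPrime (rankOneMap K (insert b A))
    have hlt : RingHom.ker (rankOneMap K A) < RingHom.ker (rankOneMap K (insert b A)) :=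
      SetLike.lt_iff_le_and_exists.mpr ⟨ker_rankOneMap_le_insert hb, genericMinor K a b,
        genericMinor_mem_ker_rankOneMap (Finset.mem_insert_of_mem ha) (Finset.mem_insert_self b A),
        genericMinor_notMem_ker_rankOneMap ha hb⟩
    rw [Finset.card_cons, Finset.cons_eq_insert]
    push_cast
    gcongr
    exact ih.trans (Ideal.height_add_one_le_of_lt_of_isPrime hlt)

/-- A homomorphism to a field under which the generic matrix has rank at most one, with a nonzero
column `a`, factors through the generic rank one substitution. -/
theorem exists_comp_rankOneMap_eq [Fintype V] {L : Type*} [Field L]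
    (φ : MvPolynomial (Fin 2 × V) K →+* L) {a : V} {k : Fin 2} (hk : φ (X (k, a)) ≠ 0)
    (h : ∀ b, φ (genericMinor K a b) = 0) :
    ∃ ψ : MvPolynomial (Fin 2 × V ⊕ Fin 2) K →+* L,
      ∀ f, φ f = ψ (rankOneMap K Finset.univ f) := by
  have hrel : ∀ b, φ (X (0, a)) * φ (X (1, b)) = φ (X (0, b)) * φ (X (1, a)) := fun b => by
    rw [← map_mul, ← map_mul, ← sub_eq_zero, ← map_sub]
    exact h b
  obtain ⟨w, hw⟩ : ∃ w : V → L, ∀ j b, φ (X (j, b)) = φ (X (j, a)) * w b := by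
    -- The vanishing minors make this ratio to column `a` the same in both rows.
    refine ⟨fun b => φ (X (k, b)) / φ (X (k, a)), fun j b => ?_⟩
    have := hrel b
    rw [← mul_div_assoc, eq_div_iff hk]
    fin_cases j <;> fin_cases k <;> simp only [Fin.zero_eta, Fin.mk_one] <;>
      first | ring1 | linear_combination this | linear_combination -this
  let ψ : MvPolynomial (Fin 2 × V ⊕ Fin 2) K →+* L := eval₂Hom (φ.comp C)
    (Sum.elim (fun i : Fin 2 × V => w i.2) fun j => φ (X (j, a)))
  have hfac : φ = ψ.comp (rankOneMap K (Finset.univ : Finset V)).toRingHom := by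
    refine ringHom_ext (fun x => ?_) fun i => ?_
    · have hC : rankOneMap K (Finset.univ : Finset V) (C x) = C x :=
        (rankOneMap K Finset.univ).commutes x
      rw [RingHom.comp_apply, AlgHom.toRingHom_eq_coe, RingHom.coe_coe, hC, coe_eval₂Hom, eval₂_C]
      rfl
    · rw [RingHom.comp_apply, AlgHom.toRingHom_eq_coe, RingHom.coe_coe, rankOneMap_X,
        if_pos (Finset.mem_univ _)]
      simp [ψ, hw i.1 i.2]
  exact ⟨ψ, fun f => DFunLike.congr_fun hfac f⟩

/-- A prime that contains the minors with a fixed column that is nonzero modulo the prime contains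
the kernel of the generic rank one substitution. -/
theorem ker_rankOneMap_univ_le [Fintype V] {P : Ideal (MvPolynomial (Fin 2 × V) K)} [P.IsPrime]
    {a : V} {k : Fin 2} (ha : X (k, a) ∉ P) (h : ∀ b, genericMinor K a b ∈ P) :
    RingHom.ker (rankOneMap K (Finset.univ : Finset V)) ≤ P := by
  obtain ⟨ψ, hψ⟩ := exists_comp_rankOneMap_eq
    (algebraMap (MvPolynomial (Fin 2 × V) K) P.ResidueField) (k := k)
    (fun h0 => ha (Ideal.algebraMap_residueField_eq_zero.mp h0))
    fun b => Ideal.algebraMap_residueField_eq_zero.mpr (h b)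
  intro f hf
  rw [RingHom.mem_ker] at hf
  rw [← Ideal.algebraMap_residueField_eq_zero, hψ, hf, map_zero]

/-- The kernel is minimal over the minors through one fixed column `a`: a smaller prime still omits
`X (0, a)`. Krull's height theorem then applies. -/
theorem height_ker_rankOneMap_univ_le [Fintype V] [Nonempty V] :
    (RingHom.ker (rankOneMap K (Finset.univ : Finset V))).height ≤
      (Fintype.card V - 1 : ℕ) := by
  classical
  obtain ⟨a⟩ := ‹Nonempty V›
  have := RingHom.ker_isPrime (rankOneMap K (Finset.univ : Finset V))
  let t : Finset (MvPolynomial (Fin 2 × V) K) := (Finset.univ.erase a).image (genericMinor K a)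
  have hmin : RingHom.ker (rankOneMap K (Finset.univ : Finset V)) ∈
      (Ideal.span (t : Set (MvPolynomial (Fin 2 × V) K))).minimalPrimes := by
    refine ⟨⟨this, Ideal.span_le.mpr fun f hf => ?_⟩, fun P hP hle => ?_⟩
    · obtain ⟨b, -, rfl⟩ := Finset.mem_image.mp (Finset.mem_coe.mp hf)
      exact genericMinor_mem_ker_rankOneMap (Finset.mem_univ _) (Finset.mem_univ _)
    · have := hP.1
      refine ker_rankOneMap_univ_le (a := a) (k := 0) (fun h0 => ?_) fun b => ?_
      · have := hle h0
        rw [RingHom.mem_ker, rankOneMap_X, if_pos (Finset.mem_univ _)] at this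
        exact mul_ne_zero (X_ne_zero _) (X_ne_zero _) this
      · by_cases hb : b = a
        · rw [hb, genericMinor, sub_self]
          exact P.zero_mem
        · exact hP.2 (Ideal.subset_span (Finset.mem_coe.mpr
            (Finset.mem_image_of_mem _ (Finset.mem_erase.mpr ⟨hb, Finset.mem_univ _⟩))))
  refine (Ideal.height_le_card_of_mem_minimalPrimes_span_finset hmin).trans ?_
  exact_mod_cast Finset.card_image_le.trans (by rw [Finset.card_erase_of_mem (Finset.mem_univ _)]; rfl)

end Rank

end MvPolynomial

/-! ### Identities for minors -/

namespace MvPolynomial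

section Minors

variable {V : Type u} {K : Type v} [Field K]

theorem genericMinor_swap (a b : V) : genericMinor K b a = -genericMinor K a b := by
  rw [genericMinor, genericMinor]
  ring

theorem genericMinor_ne_zero {a b : V} (hab : a ≠ b) : genericMinor K a b ≠ 0 := by
  classical
  intro h
  have := congrArg (eval fun i : Fin 2 × V => if i = (0, a) ∨ i = (1, b) then (1 : K) else 0) h
  simp [genericMinor, hab, hab.symm] at this

theorem genericMinor_isHomogeneous (a b : V) : (genericMinor K a b).IsHomogeneous 2 :=
  ((isHomogeneous_X K _).mul (isHomogeneous_X K _)).sub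
    ((isHomogeneous_X K _).mul (isHomogeneous_X K _))

/-- Expansion of a 3 × 3 determinant with row `l` repeated. -/
theorem X_mul_genericMinor (l : Fin 2) (a b c : V) :
    X (l, b) * genericMinor K a c =
      X (l, a) * genericMinor K b c + X (l, c) * genericMinor K a b := by
  fin_cases l <;> simp only [genericMinor, Fin.zero_eta, Fin.mk_one] <;> ring

theorem genericMinor_mem_span_of_X_mem {I : Ideal (MvPolynomial (Fin 2 × V) K)} {a b : V}
    (h : (∀ k, X (k, a) ∈ I) ∨ ∀ k, X (k, b) ∈ I) : genericMinor K a b ∈ I := by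
  rcases h with h | h
  · exact I.sub_mem (I.mul_mem_right _ (h 0)) (I.mul_mem_left _ (h 1))
  · exact I.sub_mem (I.mul_mem_left _ (h 1)) (I.mul_mem_right _ (h 0))

end Minors

end MvPolynomial

/-! ### From a path to König type -/

namespace SimpleGraph

open MvPolynomial

variable {V : Type u} {K : Type v} [Field K] {G : SimpleGraph V}

theorem binomialEdgeIdeal_eq_span (G : SimpleGraph V) : G.binomialEdgeIdeal K =
    Ideal.span {f | ∃ a b : V, G.Adj a b ∧ f = genericMinor K a b} :=
  rfl

theorem binomialEdgeIdeal_le_iff {I : Ideal (MvPolynomial (Fin 2 × V) K)} :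
    G.binomialEdgeIdeal K ≤ I ↔ ∀ a b, G.Adj a b → genericMinor K a b ∈ I := by
  rw [binomialEdgeIdeal_eq_span, Ideal.span_le]
  constructor
  · exact fun h a b hab => h ⟨a, b, hab, rfl⟩
  · rintro h _ ⟨a, b, hab, rfl⟩
    exact h a b hab

/-- The minors of the edges, oriented by means of `g`, minimally generate the binomial edge
ideal. -/
theorem isMinimalHomogeneousGenerators_binomialEdgeIdeal [Finite V] (G : SimpleGraph V) {g : V → ℕ}
    (hg : Function.Injective g) : IsMinimalHomogeneousGenerators
      {f | ∃ a b : V, G.Adj a b ∧ g a < g b ∧ f = genericMinor K a b} (G.binomialEdgeIdeal K) := by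
  classical
  have := Fintype.ofFinite V
  refine ⟨?_, le_antisymm ?_ ?_, ?_⟩
  · rintro _ ⟨a, b, -, -, rfl⟩
    exact ⟨2, genericMinor_isHomogeneous a b⟩
  · rw [Ideal.span_le]
    rintro _ ⟨a, b, hab, -, rfl⟩
    exact binomialEdgeIdeal_le_iff.mp le_rfl a b hab
  · refine binomialEdgeIdeal_le_iff.mpr fun a b hab => ?_
    rcases lt_or_gt_of_ne (hg.ne hab.ne) with h | h
    · exact Ideal.subset_span ⟨a, b, hab, h, rfl⟩
    · rw [genericMinor_swap, Ideal.neg_mem_iff]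
      exact Ideal.subset_span ⟨b, a, hab.symm, h, rfl⟩
  · rintro _ ⟨a, b, hab, hlt, rfl⟩ hmem
    -- Setting all columns but `a` and `b` to zero kills every other generator.
    let A : Finset (Fin 2 × V) := {i | i.2 ≠ a ∧ i.2 ≠ b}
    have hle : Ideal.span ({f | ∃ a b : V, G.Adj a b ∧ g a < g b ∧ f = genericMinor K a b} \
        {genericMinor K a b}) ≤ RingHom.ker (killVars (K := K) A) := by
      rw [Ideal.span_le]
      rintro _ ⟨⟨c, d, hcd, hlt', rfl⟩, hne⟩
      refine genericMinor_mem_span_of_X_mem ?_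
      simp only [RingHom.mem_ker, killVars_X, A, Finset.mem_filter_univ, ite_eq_left_iff]
      by_contra hcon
      have hc : c = a ∨ c = b := by grind
      have hd : d = a ∨ d = b := by grind
      apply hne
      have : c = a ∧ d = b := by grind
      rw [this.1, this.2]
      rfl
    have h0 := hle hmem
    rw [RingHom.mem_ker, genericMinor] at h0
    simp only [map_sub, map_mul, killVars_X, A, Finset.mem_filter_univ] at h0
    apply genericMinor_ne_zero (K := K) hab.ne
    simpa [genericMinor] using h0

/-- If `h` is the height of `J_G` and `G` has a path with `h` edges, then `J_G` is of König type. -/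
theorem isKonigType_binomialEdgeIdeal_of_path [Finite V] (G : SimpleGraph V) {h : ℕ}
    (p : Fin (h + 1) → V) (hp : Function.Injective p)
    (hadj : ∀ i : Fin h, G.Adj (p i.castSucc) (p i.succ))
    (hh : (h : ℕ∞) = (G.binomialEdgeIdeal K).height) : IsKonigType (G.binomialEdgeIdeal K) := by
  classical
  obtain ⟨n, ⟨e⟩⟩ := Finite.exists_equiv_fin V
  -- Path vertices are numbered by position, the others after them.
  let g : V → ℕ := Function.extend p (fun i => i.val) fun v => h + 1 + e v
  have hgp : ∀ i, g (p i) = i.val := fun i => hp.extend_apply _ _ _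
  have hgn : ∀ v, (¬ ∃ i, p i = v) → g v = h + 1 + e v := fun v hv =>
    Function.extend_apply' _ _ _ hv
  have hg : Function.Injective g := by
    intro v w hvw
    by_cases hv : ∃ i, p i = v <;> by_cases hw : ∃ i, p i = w
    · obtain ⟨i, rfl⟩ := hv
      obtain ⟨j, rfl⟩ := hw
      rw [hgp, hgp] at hvw
      rw [Fin.ext hvw]
    · obtain ⟨i, rfl⟩ := hv
      rw [hgp, hgn w hw] at hvw
      omega
    · obtain ⟨j, rfl⟩ := hw
      rw [hgp, hgn v hv] at hvw
      omega
    · rw [hgn v hv, hgn w hw] at hvw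
      exact e.injective (Fin.ext (by omega))
  obtain ⟨m, hm⟩ := exists_diagonal_monomialOrder K g hg
  have hdeg : ∀ i : Fin h, m.degree (genericMinor K (p i.castSucc) (p i.succ)) =
      Finsupp.single (0, p i.castSucc) 1 + Finsupp.single (1, p i.succ) 1 := fun i =>
    hm _ _ (by rw [hgp, hgp]; simp)
  have hsupp : ∀ i : Fin h, ∀ v, m.degree (genericMinor K (p i.castSucc) (p i.succ)) v ≠ 0 ↔
      v = (0, p i.castSucc) ∨ v = (1, p i.succ) := fun i v => by
    rw [hdeg, Finsupp.add_apply, Finsupp.single_apply, Finsupp.single_apply]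
    grind
  refine ⟨m, List.ofFn fun i : Fin h => genericMinor K (p i.castSucc) (p i.succ), ?_, ?_,
    ⟨_, isMinimalHomogeneousGenerators_binomialEdgeIdeal G hg, ?_⟩, ?_⟩
  · rw [List.length_ofFn, hh]
  · refine List.nodup_ofFn.mpr fun i j hij => ?_
    have := (hsupp j (0, p i.castSucc)).mp
      (by rw [← show genericMinor K _ _ = genericMinor K _ _ from hij, hsupp]; exact Or.inl rfl)
    rcases this with h1 | h1
    · exact Fin.castSucc_injective _ (hp (Prod.mk.inj h1).2)
    · simp at h1
  · intro f hf
    obtain ⟨i, rfl⟩ := List.mem_ofFn.mp hf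
    exact ⟨_, _, hadj i, by rw [hgp, hgp]; simp, rfl⟩
  · have hmap : (List.ofFn fun i : Fin h => genericMinor K (p i.castSucc) (p i.succ)).map
        m.initialMonomial = (List.ofFn fun i : Fin h =>
          m.degree (genericMinor K (p i.castSucc) (p i.succ))).map fun e => monomial e (1 : K) := by
      rw [List.map_ofFn, List.map_ofFn]
      rfl
    rw [hmap]
    apply isRegular_map_monomial
    · intro e he
      obtain ⟨i, rfl⟩ := List.mem_ofFn.mp he
      intro h0
      have := (hsupp i _).mpr (Or.inl rfl)
      rw [h0] at this
      exact this rfl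
    · rw [List.pairwise_ofFn]
      intro i j hij
      rw [Finset.disjoint_left]
      intro v hv hv'
      rw [Finsupp.mem_support_iff, hsupp] at hv hv'
      rcases hv with rfl | rfl <;> rcases hv' with h1 | h1
      · exact hij.ne (Fin.castSucc_injective _ (hp (Prod.mk.inj h1).2))
      · simp at h1
      · simp at h1
      · exact hij.ne (Fin.succ_injective _ (hp (Prod.mk.inj h1).2))

/-! ### The height of the binomial edge ideal -/

section Multipartite

open Finset

variable [Fintype V] {r : ℕ} {part : V → Fin r}

theorem le_height_binomialEdgeIdeal (hG : ∀ a b : V, G.Adj a b ↔ part a ≠ part b) (i₀ : Fin r)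
    (hmax : ∀ i, #{v | part v = i} ≤ #{v | part v = i₀}) :
    (min (Fintype.card V - 1) (2 * #{v | part v ≠ i₀}) : ℕ) ≤ (G.binomialEdgeIdeal K).height := by
  classical
  rw [Ideal.height_eq_inf_minimalPrimes]
  refine le_iInf₂ fun P hP => ?_
  have := hP.isPrime
  have hmem : ∀ a b, part a ≠ part b → genericMinor K a b ∈ P := fun a b hab =>
    binomialEdgeIdeal_le_iff.mp hP.1.2 a b ((hG a b).mpr hab)
  by_cases hex : ∃ a b, part a ≠ part b ∧ (∃ k, X (k, a) ∉ P) ∧ ∃ l, X (l, b) ∉ P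
  · obtain ⟨a, b, hab, ⟨k, hk⟩, l, hl⟩ := hex
    have hle := ker_rankOneMap_univ_le hk fun c => by
      -- If `c` shares the part of `a`, both are adjacent to `b`; the determinant relation puts `X
      -- (l, b)` times the minor in `P`, and `X (l, b) ∉ P`.
      by_cases hc : part a = part c
      · refine (Ideal.IsPrime.mem_or_mem this ?_).resolve_left hl
        rw [X_mul_genericMinor]
        exact P.add_mem (P.mul_mem_left _ (hmem b c (hc ▸ hab.symm))) (P.mul_mem_left _ (hmem a b hab))
      · exact hmem a c hc
    refine le_trans ?_ (Ideal.height_mono hle)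
    have hcard := card_le_height_ker_rankOneMap_add_one (K := K) (A := (univ : Finset V))
      ⟨a, mem_univ a⟩
    rw [card_univ] at hcard
    refine (Nat.cast_le.mpr (min_le_left _ _)).trans ?_
    push_cast
    exact tsub_le_iff_right.mpr hcard
  -- All columns nonzero modulo `P` lie in one part.
  · obtain ⟨i, hi⟩ : ∃ i, ∀ v, part v ≠ i → ∀ k, X (k, v) ∈ P := by
      by_cases hx : ∃ a k, X (k, a) ∉ P
      · obtain ⟨a, k, hk⟩ := hx
        refine ⟨part a, fun v hv l => ?_⟩
        by_contra hl
        exact hex ⟨v, a, hv, ⟨l, hl⟩, k, hk⟩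
      · push Not at hx
        exact ⟨i₀, fun v _ k => hx v k⟩
    have hA := card_le_height_of_X_mem ((univ : Finset (Fin 2)) ×ˢ ({v | part v ≠ i} : Finset V))
      (I := P) fun j hj => hi j.2 (by simpa using hj) j.1
    refine le_trans (Nat.cast_le.mpr ((min_le_right _ _).trans ?_)) hA
    rw [card_product, card_univ, Fintype.card_fin]
    have h1 := card_filter_add_card_filter_not (s := univ) (fun v => part v = i)
    have h2 := card_filter_add_card_filter_not (s := univ) (fun v => part v = i₀)
    have := hmax i
    simp only [ne_eq]
    omega

theorem height_binomialEdgeIdeal_le [Nonempty V] (hG : ∀ a b : V, G.Adj a b ↔ part a ≠ part b)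
    (i₀ : Fin r) : (G.binomialEdgeIdeal K).height ≤
      (min (Fintype.card V - 1) (2 * #{v | part v ≠ i₀}) : ℕ) := by
  classical
  rw [Nat.mono_cast.map_min]
  refine le_min ?_ ?_
  · refine le_trans (Ideal.height_mono (binomialEdgeIdeal_le_iff.mpr fun a b _ => ?_))
      height_ker_rankOneMap_univ_le
    exact genericMinor_mem_ker_rankOneMap (mem_univ a) (mem_univ b)
  · let t : Finset (MvPolynomial (Fin 2 × V) K) :=
      ((univ : Finset (Fin 2)) ×ˢ ({v | part v ≠ i₀} : Finset V)).image X
    have ht : ∀ k v, part v ≠ i₀ → X (k, v) ∈ Ideal.span (t : Set (MvPolynomial (Fin 2 × V) K)) :=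
      fun k v hv => Ideal.subset_span (mem_coe.mpr (mem_image_of_mem _ (by simpa using hv)))
    refine (Ideal.height_mono (binomialEdgeIdeal_le_iff.mpr fun a b hab => ?_)).trans
      ((height_span_le_card t (span_ne_top_of_eval_eq_zero fun f hf => ?_)).trans ?_)
    · refine genericMinor_mem_span_of_X_mem ?_
      by_cases ha : part a = i₀
      · exact Or.inr fun k => ht k b (ha ▸ ((hG a b).mp hab).symm)
      · exact Or.inl fun k => ht k a ha
    · obtain ⟨j, -, rfl⟩ := mem_image.mp (mem_coe.mp hf)
      simp
    · refine Nat.cast_le.mpr (card_image_le.trans ?_)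
      rw [card_product, card_univ, Fintype.card_fin]

end Multipartite

end SimpleGraph

theorem mainTheorem7 {V : Type u} [Finite V] (K : Type v) [Field K] (r : ℕ) (hr : 2 ≤ r)
    (G : SimpleGraph V) (hG : G.IsCompletePartite r) :
    MvPolynomial.IsKonigType (G.binomialEdgeIdeal K) := by
  classical
  have := Fintype.ofFinite V
  obtain ⟨part, hsurj, hadj⟩ := hG
  have : Nonempty (Fin r) := ⟨⟨0, by omega⟩⟩
  have : Nonempty V := hsurj.nonempty
  obtain ⟨i₀, hmax⟩ := Finite.exists_max fun i => ({v | part v = i} : Finset V).card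
  obtain ⟨p, hp, hpath⟩ := exists_path_of_part part i₀ hmax Fintype.card_pos
  exact SimpleGraph.isKonigType_binomialEdgeIdeal_of_path G p hp
    (fun i => (hadj _ _).mpr (hpath i))
    (le_antisymm (SimpleGraph.le_height_binomialEdgeIdeal hadj i₀ hmax)
      (SimpleGraph.height_binomialEdgeIdeal_le hadj i₀))
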